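/- Let $L$ be an oriented link in $S^3$ with $\mu\ge 1$ components and let $V$ be an $n\times n$ Seifert matrix of $L$ coming from a connected Seifert surface of genus $g$ (so $n=2g+\mu-1$). For $i\ge 1$ let $\Delta_i\in\mathbb{Z}[t,t^{-1}]$ be the greatest common divisor (well defined up to units) of all $(2g+\mu-i)$-minors of $tV-V^{\mathsf T}$, a $0$-minor being $1$, and let $A_L$ be the first of $\Delta_1,\Delta_2,\dots$ that is nonzero. For $\omega\in S^1\subset\mathbb{C}$ let $$\sigma_L(\omega)=\operatorname{sign}\bigl((1-\omega)V+(1-\omega^{-1})V^{\mathsf T}\bigr)$$ be the Levine--Tristram signature (number of positive minus number of negative eigenvalues), let $\sigma_L^{\pm}(e^{2\pi i x})=\lim_{y\to x^{\pm}}\sigma_L(e^{2\pi i y})$, and define the one-sided jumps $\mathrm{ju}^{\pm}(\omega)=\pm(\sigma_L^{\pm}(\omega)-\sigma_L(\omega))$ and the total jump $\mathrm{ju}(\omega)=\mathrm{ju}^+(\omega)+\mathrm{ju}^-(\omega)$. Let $\mathrm{mult}_\omega(A_L)$ be the multiplicity of $\omega$ as a root of $A_L$. Then for every $\omega\in S^1$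 with $\omega\neq\pm1$ the one-sided limits $\sigma_L^{\pm}(\omega)$ exist and $$\mathrm{ju}(\omega)\equiv 2\,\mathrm{mult}_\omega(A_L)\pmod 4.$$ If moreover $\mathrm{mult}_\omega(A_L)=1$, then $\mathrm{ju}^+(\omega)=\mathrm{ju}^-(\omega)$, and this common value is $1$ or $-1$. -/

import Mathlib

open Filter Topology
open scoped LaurentPolynomial Matrix

noncomputable section

/-! ### Oriented links in the 3-sphere and linking numbers -/

/-- Euclidean 4-space; the 3-sphere is its unit sphere, oriented so that `(u, v, w)` is a positive
basis of the tangent space at `x` exactly when `det (x, u, v, w) > 0`. -/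
abbrev E4 : Type := EuclideanSpace ℝ (Fin 4)

/-- Euclidean 3-space. -/
abbrev E3 : Type := EuclideanSpace ℝ (Fin 3)

/-- The determinant of four vectors of 4-space. -/
def det4 (a b c d : E4) : ℝ :=
  Matrix.det (Matrix.of ![a.ofLp, b.ofLp, c.ofLp, d.ofLp])

/-- The determinant of three vectors of 3-space. -/
def det3 (a b c : E3) : ℝ :=
  Matrix.det (Matrix.of ![a.ofLp, b.ofLp, c.ofLp])

/-- A smooth closed curve in the 3-sphere, parametrized with period `1`. It need not be immersed
or injective. -/
structure IsSmoothLoop (c : ℝ → E4) : Prop where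
  smooth : ContDiff ℝ (⊤ : ℕ∞) c
  periodic : Function.Periodic c 1
  norm_eq_one : ∀ t, ‖c t‖ = 1

/-- An oriented link in the 3-sphere: a nonempty finite family of pairwise disjoint, smoothly
embedded, oriented (by their parametrizations) circles. -/
structure OrientedLink where
  numComponents : ℕ
  numComponents_pos : 0 < numComponents
  component : Fin numComponents → ℝ → E4
  isSmoothLoop : ∀ i, IsSmoothLoop (component i)
  deriv_ne_zero : ∀ i t, deriv (component i) t ≠ 0
  embedded : ∀ i j s t, component i s = component j t → i = j ∧ ∃ m : ℤ, s - t = m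

/-- The underlying point set of a link. -/
def OrientedLink.support (L : OrientedLink) : Set E4 := ⋃ i, Set.range (L.component i)

/-- Stereographic projection of the 3-sphere to 3-space, from the point that the rotation `R` takes
to `(0,0,0,1)`. It preserves the orientation. -/
def stereoProj (R : Matrix (Fin 4) (Fin 4) ℝ) (x : E4) : E3 :=
  WithLp.toLp 2 fun i : Fin 3 => (R *ᵥ x.ofLp) i.castSucc / (1 - (R *ᵥ x.ofLp) 3)

/-- Gauss's linking integral of two closed curves of period `1` in 3-space. -/
def gaussLinkingIntegral (a b : ℝ → E3) : ℝ :=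
  1 / (4 * Real.pi) *
    ∫ s in (0 : ℝ)..1, ∫ t in (0 : ℝ)..1,
      det3 (a s - b t) (deriv a s) (deriv b t) / ‖a s - b t‖ ^ 3

/-- `k` is the linking number of the disjoint closed curves `a` and `b` in the 3-sphere. It is
computed by the Gauss integral after stereographic projection from a point on neither curve (the
value does not depend on that point). -/
def HasLinkingNumber (a b : ℝ → E4) (k : ℤ) : Prop :=
  (∀ s t, a s ≠ b t) ∧
  ∃ R ∈ Matrix.specialOrthogonalGroup (Fin 4) ℝ,
    (∀ t, (R *ᵥ (a t).ofLp) 3 ≠ 1) ∧ (∀ t, (R *ᵥ (b t).ofLp) 3 ≠ 1) ∧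
    gaussLinkingIntegral (fun t => stereoProj R (a t)) (fun t => stereoProj R (b t)) = k

/-! ### Seifert surfaces and Seifert matrices -/

/-- A connected Seifert surface of the oriented link `L`: a compact connected oriented smooth
surface in the 3-sphere with oriented boundary `L`. The orientation is given by the unit normal
field `normal`. Near each of its points the surface is the piece `h = 0`, `0 ≤ g` of the
sphere, where the tangential gradient of `h` is a positive multiple of the normal, where `g`
vanishes exactly at the points of `L`, and where (outward conormal, tangent of `L`) is, with the
normal in front, a positive basis of the tangent space of the sphere at the points of `L`. The last
condition contains the independence of the tangential gradients of `g` and `h`. -/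
structure SeifertSurface (L : OrientedLink) where
  carrier : Set E4
  normal : E4 → E4
  isCompact : IsCompact carrier
  isConnected : IsConnected carrier
  support_subset : L.support ⊆ carrier
  norm_normal : ∀ x ∈ carrier, ‖normal x‖ = 1
  inner_normal : ∀ x ∈ carrier, inner ℝ x (normal x) = 0
  locally_smooth : ∀ p ∈ carrier, ∃ (U : Set E4) (h g : E4 → ℝ),
    IsOpen U ∧ p ∈ U ∧ ContDiff ℝ (⊤ : ℕ∞) h ∧ ContDiff ℝ (⊤ : ℕ∞) g ∧
    (∀ x ∈ U, x ∈ carrier ↔ ‖x‖ = 1 ∧ h x = 0 ∧ 0 ≤ g x) ∧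
    (∀ x ∈ U, x ∈ carrier → ∃ c : ℝ, 0 < c ∧
      ∀ v : E4, inner ℝ x v = 0 → inner ℝ (gradient h x) v = c * inner ℝ (normal x) v) ∧
    (∀ x ∈ U, x ∈ carrier → (g x = 0 ↔ x ∈ L.support)) ∧
    (∀ i t, L.component i t ∈ U →
      0 < det4 (L.component i t) (normal (L.component i t)) (-gradient g (L.component i t))
        (deriv (L.component i) t))

/-- The curve `c` on the surface, pushed off the surface by the angle `ε` in the positive normal
direction. -/
def SeifertSurface.pushOff {L : OrientedLink} (F : SeifertSurface L) (ε : ℝ) (c : ℝ → E4) :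
    ℝ → E4 :=
  fun t => Real.cos ε • c t + Real.sin ε • F.normal (c t)

/-- `V` is a Seifert matrix of the Seifert surface `F`: there are smooth closed curves `c i` on `F`
(based at a common point) whose classes form a basis of `H₁(F; ℤ)`, the abelianized fundamental
group of `F`, such that `V i j` is the linking number of `c i` with the positive push-off of
`c j`. Here `n` is the rank of `H₁(F; ℤ)`, which is `2 g + μ - 1` if `F` has genus `g` and `L` has `μ`
components. -/
def SeifertSurface.IsSeifertMatrix {L : OrientedLink} (F : SeifertSurface L) {n : ℕ}
    (V : Matrix (Fin n) (Fin n) ℤ) : Prop :=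
  ∃ (x₀ : F.carrier) (p : Fin n → Path x₀ x₀) (c : Fin n → ℝ → E4),
    (∀ i, IsSmoothLoop (c i)) ∧
    (∀ i (t : unitInterval), ((p i t : F.carrier) : E4) = c i t) ∧
    (∃ b : Module.Basis (Fin n) ℤ (Additive (Abelianization (FundamentalGroup F.carrier x₀))),
      ∀ i, b i = Additive.ofMul (Abelianization.of
        (FundamentalGroup.fromPath (Path.Homotopic.Quotient.mk (p i))))) ∧
    ∀ i j, ∀ᶠ ε in 𝓝[>] (0 : ℝ), HasLinkingNumber (c i) (F.pushOff ε (c j)) (V i j)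

/-! ### Higher Alexander polynomials -/

/-- The matrix `t V - Vᵀ` over `ℤ[t, t⁻¹]`. -/
def alexanderMatrix {n : ℕ} (V : Matrix (Fin n) (Fin n) ℤ) : Matrix (Fin n) (Fin n) ℤ[T;T⁻¹] :=
  (LaurentPolynomial.T 1 : ℤ[T;T⁻¹]) • V.map (fun a => LaurentPolynomial.C a) -
    Vᵀ.map (fun a => LaurentPolynomial.C a)

/-- `D` is an `i`-th Alexander polynomial `Δᵢ` (`1 ≤ i ≤ n + 1`), i.e. a greatest common divisor in
`ℤ[t, t⁻¹]` of all minors of size `n + 1 - i = 2 g + μ - i` of `t V - Vᵀ`. It is determined up to units. -/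
def IsAlexanderPolynomial {n : ℕ} (V : Matrix (Fin n) (Fin n) ℤ) (i : ℕ) (D : ℤ[T;T⁻¹]) : Prop :=
  ∀ d : ℤ[T;T⁻¹], d ∣ D ↔
    ∀ r c : Fin (n + 1 - i) ↪o Fin n, d ∣ ((alexanderMatrix V).submatrix r c).det

/-- `A` is the first nonzero one among the Alexander polynomials `Δ₁, Δ₂, …`. -/
def IsFirstNonzeroAlexanderPolynomial {n : ℕ} (V : Matrix (Fin n) (Fin n) ℤ) (A : ℤ[T;T⁻¹]) :
    Prop :=
  A ≠ 0 ∧ ∃ i, 1 ≤ i ∧ IsAlexanderPolynomial V i A ∧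
    ∀ j, 1 ≤ j → j < i → IsAlexanderPolynomial V j 0

/-- The multiplicity of `z` as a root of a nonzero Laurent polynomial `f`: the largest `m` such that
`(t - z) ^ m` divides `f` in `ℂ[t, t⁻¹]`. -/
def rootMult (z : ℂ) (f : ℤ[T;T⁻¹]) : ℕ :=
  multiplicity (LaurentPolynomial.T 1 - LaurentPolynomial.C z : ℂ[T;T⁻¹])
    (AddMonoidAlgebra.mapRingHom ℤ (Int.castRingHom ℂ) f)

/-! ### The signature function and its jumps -/

/-- The signature of a Hermitian matrix: the number of positive eigenvalues minus the number of
negative ones, counted with multiplicity. -/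
def hermitianSignature {n : ℕ} {H : Matrix (Fin n) (Fin n) ℂ} (hH : H.IsHermitian) : ℤ :=
  (Finset.univ.filter fun i => 0 < hH.eigenvalues i).card -
    (Finset.univ.filter fun i => hH.eigenvalues i < 0).card

/-- The matrix `W(ω) = (1 - ω) V + (1 - ω⁻¹) Vᵀ`. -/
def tristramMatrix {n : ℕ} (V : Matrix (Fin n) (Fin n) ℤ) (ω : Circle) :
    Matrix (Fin n) (Fin n) ℂ :=
  (1 - (ω : ℂ)) • V.map (fun a => (a : ℂ)) + (1 - (ω : ℂ)⁻¹) • Vᵀ.map (fun a => (a : ℂ))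

theorem tristramMatrix_isHermitian {n : ℕ} (V : Matrix (Fin n) (Fin n) ℤ) (ω : Circle) :
    (tristramMatrix V ω).IsHermitian := by
  have h : (starRingEnd ℂ) (ω : ℂ) = (ω : ℂ)⁻¹ := by
    rw [← Circle.coe_inv_eq_conj, Circle.coe_inv]
  ext i j
  simp [tristramMatrix, h, add_comm]

/-- The Levine-Tristram signature function `σ(ω)` of a Seifert matrix. -/
def levineTristramSignature {n : ℕ} (V : Matrix (Fin n) (Fin n) ℤ) (ω : Circle) : ℤ :=
  hermitianSignature (tristramMatrix_isHermitian V ω)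

/-- The jump `ju⁺(ω) = σ⁺(ω) - σ(ω)` exists and equals `j`, where `σ⁺(e^{2πix})` is the limit of
`σ(e^{2πiy})` as `y` tends to `x` from above. -/
def HasJumpPlus {n : ℕ} (V : Matrix (Fin n) (Fin n) ℤ) (ω : Circle) (j : ℤ) : Prop :=
  ∀ x : ℝ, Circle.exp (2 * Real.pi * x) = ω → ∃ s : ℤ,
    Tendsto (fun y : ℝ => levineTristramSignature V (Circle.exp (2 * Real.pi * y))) (𝓝[>] x) (𝓝 s) ∧
    j = s - levineTristramSignature V ω

/-- The jump `ju⁻(ω) = -(σ⁻(ω) - σ(ω))` exists and equals `j`, where `σ⁻(e^{2πix})` is the limit of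
`σ(e^{2πiy})` as `y` tends to `x` from below. -/
def HasJumpMinus {n : ℕ} (V : Matrix (Fin n) (Fin n) ℤ) (ω : Circle) (j : ℤ) : Prop :=
  ∀ x : ℝ, Circle.exp (2 * Real.pi * x) = ω → ∃ s : ℤ,
    Tendsto (fun y : ℝ => levineTristramSignature V (Circle.exp (2 * Real.pi * y))) (𝓝[<] x) (𝓝 s) ∧
    j = -(s - levineTristramSignature V ω)

end

/-! Since `W(ω) = (ω⁻¹ - 1)(ωV - Vᵀ)`, for `ω ≠ 1` the minors of `W` are those of the Alexander
matrix up to a nonzero factor. If `A = Δᵢ` and `r = n + 1 - i`, then `W` has rank at most `r` on the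
circle, and exactly `r` on both sides of a given `ω`.

As `A` is a gcd, some `r`-minor `m(a,b)` vanishes at `ω` to exactly the order `k = mult_ω(A)`. At
rank `r` the minors satisfy `m(a,b) m(b,a) = m(a,a) m(b,b)` (`det_submatrix_mul_det_submatrix`), and
the left side is `|m(a,b)|²` because `W` is Hermitian. All orders being at least `k`, the principal
minor `m(a,a)` also has order `k` (`exists_principal_minor_eq`).

Let `pⱼ`, `qⱼ` count the positive and negative eigenvalues on the two sides of `ω`. The sign of the
principal minor is `(-1)^qⱼ`, and it changes by `(-1)^k` across `ω`; so `q₁ + q₂ ≡ k` mod 2. As `pⱼ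
+ qⱼ = r`, the total jump is `2(q₂ - q₁)`, which gives the congruence. If `k = 1`, the rank at `ω`
is at least `r - 1` (`card_le_rank_add_one_of_det_eq`); by semicontinuity and parity exactly one
eigenvalue crosses zero and changes sign. -/

noncomputable section

/-! ### Indices of Hermitian matrices -/

/-- The Hermitian form of a matrix. -/
def hermForm {m : Type*} [Fintype m] (H : Matrix m m ℂ) (x : m → ℂ) : ℝ :=
  (star x ⬝ᵥ H *ᵥ x).re

/-- The number of eigenvalues, counted with multiplicity, that have the same sign as `ε`. -/
def signIndex {m : Type*} [Fintype m] [DecidableEq m] (ε : ℝ) {H : Matrix m m ℂ}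
    (hH : H.IsHermitian) : ℕ :=
  (Finset.univ.filter fun i => 0 < ε * hH.eigenvalues i).card

/-- The Hermitian form of `H`, multiplied by `ε`, is positive definite after pullback along `B`. -/
def IsPosAlong {m d : Type*} [Fintype m] [Fintype d] (ε : ℝ) (H : Matrix m m ℂ)
    (B : Matrix m d ℂ) : Prop :=
  ∀ x : d → ℂ, x ≠ 0 → 0 < ε * hermForm H (B *ᵥ x)

section

variable {m d : Type*} [Fintype m] [Fintype d]

theorem hermForm_mul_mul (H : Matrix m m ℂ) (B : Matrix m d ℂ) (x : d → ℂ) :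
    hermForm (Bᴴ * H * B) x = hermForm H (B *ᵥ x) := by
  simp only [hermForm, Matrix.star_mulVec, ← Matrix.mulVec_mulVec, Matrix.dotProduct_mulVec,
    Matrix.vecMul_vecMul]

variable [DecidableEq m]

theorem hermForm_diagonal (a : m → ℝ) (x : m → ℂ) :
    hermForm (Matrix.diagonal fun i => (a i : ℂ)) x = ∑ i, a i * Complex.normSq (x i) := by
  simp only [hermForm, dotProduct, Matrix.mulVec_diagonal, Complex.re_sum, Pi.star_apply]
  refine Finset.sum_congr rfl fun i _ => ?_
  rw [show star (x i) * ((a i : ℂ) * x i) = (a i : ℂ) * (star (x i) * x i) by ring]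
  rw [show star (x i) * x i = (Complex.normSq (x i) : ℂ) from Complex.normSq_eq_conj_mul_self.symm]
  rw [← Complex.ofReal_mul, Complex.ofReal_re]

theorem Matrix.IsHermitian.conjTranspose_mul_mul_eigenvectorUnitary {H : Matrix m m ℂ}
    (hH : H.IsHermitian) :
    (hH.eigenvectorUnitary : Matrix m m ℂ)ᴴ * H * (hH.eigenvectorUnitary : Matrix m m ℂ) =
      Matrix.diagonal fun i => (hH.eigenvalues i : ℂ) := by
  have := hH.conjStarAlgAut_star_eigenvectorUnitary
  rw [Unitary.conjStarAlgAut_star_apply] at this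
  exact this

theorem Matrix.IsHermitian.hermForm_eigenvectorUnitary_mulVec {H : Matrix m m ℂ}
    (hH : H.IsHermitian) (x : m → ℂ) :
    hermForm H ((hH.eigenvectorUnitary : Matrix m m ℂ) *ᵥ x) =
      ∑ i, hH.eigenvalues i * Complex.normSq (x i) := by
  rw [← hermForm_mul_mul, hH.conjTranspose_mul_mul_eigenvectorUnitary, hermForm_diagonal]

theorem Matrix.IsHermitian.hermForm_eq_sum {H : Matrix m m ℂ} (hH : H.IsHermitian) (x : m → ℂ) :
    hermForm H x = ∑ i, hH.eigenvalues i *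
      Complex.normSq (((hH.eigenvectorUnitary : Matrix m m ℂ)ᴴ *ᵥ x) i) := by
  rw [← hH.hermForm_eigenvectorUnitary_mulVec, Matrix.mulVec_mulVec]
  have : (hH.eigenvectorUnitary : Matrix m m ℂ) * (hH.eigenvectorUnitary : Matrix m m ℂ)ᴴ = 1 :=
    Unitary.coe_mul_star_self hH.eigenvectorUnitary
  rw [this, Matrix.one_mulVec]

/-- One half of Sylvester's law of inertia: project to the eigencoordinates of the right sign. On
the kernel of this projection `ε` times the form is at most zero, so the kernel is trivial. -/
theorem IsPosAlong.card_le_signIndex {ε : ℝ} {H : Matrix m m ℂ} {B : Matrix m d ℂ}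
    (hB : IsPosAlong ε H B) (hH : H.IsHermitian) : Fintype.card d ≤ signIndex ε hH := by
  let U : Matrix m m ℂ := (hH.eigenvectorUnitary).1
  let f : (d → ℂ) →ₗ[ℂ] ({i // 0 < ε * hH.eigenvalues i} → ℂ) :=
    (LinearMap.funLeft ℂ ℂ Subtype.val).comp (Matrix.mulVecLin (Uᴴ * B))
  have hf : Function.Injective f := by
    rw [← LinearMap.ker_eq_bot, LinearMap.ker_eq_bot']
    intro x hx
    by_contra hne
    have hpos := hB x hne
    rw [hH.hermForm_eq_sum, Finset.mul_sum] at hpos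
    refine absurd hpos (not_lt.2 (Finset.sum_nonpos fun i _ => ?_))
    rw [← mul_assoc]
    by_cases hi : 0 < ε * hH.eigenvalues i
    · have h0 : f x ⟨i, hi⟩ = 0 := by rw [hx]; rfl
      have h1 : (Uᴴ *ᵥ B *ᵥ x) i = 0 := by
        simpa [f, LinearMap.funLeft_apply, Matrix.mulVec_mulVec] using h0
      rw [h1]; simp
    · exact mul_nonpos_of_nonpos_of_nonneg (not_lt.1 hi) (Complex.normSq_nonneg _)
  have := LinearMap.finrank_le_finrank_of_injective hf
  rw [Module.finrank_fintype_fun_eq_card, Module.finrank_fintype_fun_eq_card] at this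
  rwa [signIndex, ← Fintype.card_subtype]

theorem exists_isPosAlong (ε : ℝ) {H : Matrix m m ℂ} (hH : H.IsHermitian) :
    ∃ B : Matrix m {i // 0 < ε * hH.eigenvalues i} ℂ, IsPosAlong ε H B := by
  refine ⟨(hH.eigenvectorUnitary : Matrix m m ℂ).submatrix id Subtype.val, fun x hx => ?_⟩
  let y : m → ℂ := fun i => if h : 0 < ε * hH.eigenvalues i then x ⟨i, h⟩ else 0
  have hy : (hH.eigenvectorUnitary : Matrix m m ℂ).submatrix id Subtype.val *ᵥ x =
      (hH.eigenvectorUnitary : Matrix m m ℂ) *ᵥ y := by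
    ext i
    simp only [Matrix.mulVec, dotProduct, Matrix.submatrix_apply, id]
    rw [← Fintype.sum_subtype_add_sum_subtype (fun i => 0 < ε * hH.eigenvalues i)]
    rw [Finset.sum_eq_zero (s := (Finset.univ : Finset {i // ¬ 0 < ε * hH.eigenvalues i})), add_zero]
    · exact Finset.sum_congr rfl fun j _ => by simp only [y, dif_pos j.2]
    · intro j _
      simp only [y, dif_neg j.2, mul_zero]
  rw [hy, hH.hermForm_eigenvectorUnitary_mulVec, Finset.mul_sum]
  obtain ⟨j, hj⟩ := Function.ne_iff.1 hx
  refine Finset.sum_pos' (fun i _ => ?_) ⟨j.1, Finset.mem_univ _, ?_⟩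
  · rw [← mul_assoc]
    by_cases h : 0 < ε * hH.eigenvalues i
    · exact mul_nonneg h.le (Complex.normSq_nonneg _)
    · simp [y, dif_neg h]
  · rw [← mul_assoc]
    refine mul_pos j.2 (Complex.normSq_pos.2 ?_)
    simp only [y, dif_pos j.2]
    exact hj

/-- The submatrix is the pullback of `H` along the selection matrix of `e`, so a definite subspace
for it maps to one for `H`. -/
theorem signIndex_submatrix_le [DecidableEq d] (ε : ℝ) {H : Matrix m m ℂ} (hH : H.IsHermitian)
    (e : d → m) : signIndex ε (hH.submatrix e) ≤ signIndex ε hH := by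
  obtain ⟨B, hB⟩ := exists_isPosAlong ε (hH.submatrix e)
  have h : IsPosAlong ε H ((1 : Matrix m m ℂ).submatrix id e * B) := fun x hx => by
    rw [← Matrix.mulVec_mulVec, ← hermForm_mul_mul]
    convert hB x hx using 3
    ext i j
    simp [Matrix.mul_apply, Matrix.one_apply]
  have := h.card_le_signIndex hH
  rwa [Fintype.card_subtype] at this

theorem signIndex_add_signIndex {H : Matrix m m ℂ} (hH : H.IsHermitian) :
    signIndex 1 hH + signIndex (-1) hH = H.rank := by
  rw [hH.rank_eq_card_non_zero_eigs, Fintype.card_subtype, signIndex, signIndex,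
    ← Finset.card_union_of_disjoint]
  · congr 1
    ext i
    simp [lt_or_lt_iff_ne, ne_comm]
  · rw [Finset.disjoint_filter]
    intro i _ h1 h2
    linarith

theorem hermitianSignature_eq {n : ℕ} {H : Matrix (Fin n) (Fin n) ℂ} (hH : H.IsHermitian) :
    hermitianSignature hH = (signIndex 1 hH : ℤ) - signIndex (-1) hH := by
  simp [hermitianSignature, signIndex]

theorem neg_one_pow_signIndex_mul_det_pos {H : Matrix m m ℂ} (hH : H.IsHermitian)
    (hdet : H.det ≠ 0) : 0 < (-1) ^ signIndex (-1) hH * H.det.re := by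
  have h : H.det = ((∏ i, hH.eigenvalues i : ℝ) : ℂ) := by
    rw [hH.det_eq_prod_eigenvalues]; push_cast; rfl
  have hne : ∏ i, hH.eigenvalues i ≠ 0 := by
    rintro h0
    rw [h0] at h
    exact hdet (by simpa using h)
  rw [h, Complex.ofReal_re]
  have hs : ((-1 : ℝ)) ^ signIndex (-1) hH = ∏ i, if 0 < -1 * hH.eigenvalues i then (-1 : ℝ) else 1 := by
    rw [Finset.prod_ite]; simp [signIndex]
  rw [hs, ← Finset.prod_mul_distrib]
  refine Finset.prod_pos fun i _ => ?_
  have hi := Finset.prod_ne_zero_iff.1 hne i (Finset.mem_univ _)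
  split_ifs with h
  · exact h
  · rw [one_mul]
    exact lt_of_le_of_ne (by linarith) hi.symm

theorem im_det_eq_zero {H : Matrix m m ℂ} (hH : H.IsHermitian) : H.det.im = 0 := by
  rw [hH.det_eq_prod_eigenvalues]
  simpa using Complex.ofReal_im (∏ i, hH.eigenvalues i)

end

/-! ### Minors and rank -/

/-- Sorting the indices puts minors into the increasing form used by `IsAlexanderPolynomial`. -/
theorem exists_comp_strictMono {k n : ℕ} {g : Fin k → Fin n} (hg : Function.Injective g) :
    ∃ (σ : Equiv.Perm (Fin k)) (f : Fin k ↪o Fin n), ⇑f = g ∘ σ :=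
  ⟨Tuple.sort g, OrderEmbedding.ofStrictMono (g ∘ Tuple.sort g)
    ((Tuple.monotone_sort g).strictMono_of_injective (hg.comp (Tuple.sort g).injective)), rfl⟩

theorem exists_orderEmbedding_linearIndependent_row {K : Type*} [Field K] {m n r : ℕ}
    (M : Matrix (Fin m) (Fin n) K) (hr : M.rank = r) :
    ∃ f : Fin r ↪o Fin m, LinearIndependent K (M.submatrix f id).row := by
  rw [M.rank_eq_finrank_span_row] at hr
  subst hr
  obtain ⟨v, hv, -, hli⟩ := Submodule.exists_fun_fin_finrank_span_eq K (Set.range M.row)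
  choose g hg using hv
  have hgv : M.row ∘ g = v := funext hg
  obtain ⟨σ, f, hf⟩ := exists_comp_strictMono
    (g := g) (fun a b hab => hli.injective (by rw [← hg, ← hg, hab]))
  refine ⟨f, ?_⟩
  have h := hli.comp σ σ.injective
  rw [← hgv, Function.comp_assoc, ← hf] at h
  exact h

theorem exists_minor_ne_zero {K : Type*} [Field K] {m n : ℕ} (M : Matrix (Fin m) (Fin n) K) :
    ∃ (f : Fin M.rank ↪o Fin m) (g : Fin M.rank ↪o Fin n), (M.submatrix f g).det ≠ 0 := by
  obtain ⟨f, hf⟩ := exists_orderEmbedding_linearIndependent_row M rfl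
  obtain ⟨g, hg⟩ := exists_orderEmbedding_linearIndependent_row (M.submatrix f id)ᵀ
    (r := M.rank) (by rw [Matrix.rank_transpose]; simpa using hf.rank_matrix)
  refine ⟨f, g, ?_⟩
  have h := (Matrix.isUnit_iff_isUnit_det _).1 (Matrix.linearIndependent_rows_iff_isUnit.1 hg)
  rw [← Matrix.det_transpose]
  exact h.ne_zero

theorem det_submatrix_ne_zero_le_rank {K m : Type*} [Field K] [Fintype m] {r : ℕ}
    {M : Matrix m m K} {f g : Fin r → m} (h : (M.submatrix f g).det ≠ 0) : r ≤ M.rank := by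
  have h1 := Matrix.rank_of_det_ne_zero h
  rw [Fintype.card_fin] at h1
  rw [← h1]
  exact Matrix.rank_submatrix_le M f g

/-- A rank factorization `M = XY` through `K^r` makes every `r`-minor a product of a factor
depending on the rows and one depending on the columns. -/
theorem det_submatrix_mul_det_submatrix {K m : Type*} [Field K] [Fintype m] [DecidableEq m]
    (M : Matrix m m K) {r : ℕ} (hr : M.rank = r) (f g : Fin r → m) :
    (M.submatrix f g).det * (M.submatrix g f).det =
      (M.submatrix f f).det * (M.submatrix g g).det := by
  subst hr
  obtain ⟨V, U, e, hV, hU, h⟩ := M.exists_rank_normal_form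
  let P : Matrix m (Fin M.rank) K := Matrix.of fun i k => if e i = Sum.inl k then 1 else 0
  have hP : (Matrix.fromBlocks 1 0 0 0 : Matrix (Fin M.rank ⊕ Fin (Fintype.card m - M.rank)) _ K).submatrix e e = P * Pᵀ := by
    ext i j
    simp only [Matrix.submatrix_apply, Matrix.mul_apply, P, Matrix.of_apply, Matrix.transpose_apply]
    rcases e i with a | a <;> rcases e j with b | b <;>
      simp [Matrix.one_apply, eq_comm]
  have hM : M = (V⁻¹ * P) * (Pᵀ * U⁻¹) := by
    rw [← Matrix.mul_assoc, Matrix.mul_assoc V⁻¹, ← hP, ← h, Matrix.mul_assoc, Matrix.mul_assoc,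
      Matrix.mul_nonsing_inv _ ((Matrix.isUnit_iff_isUnit_det _).1 hU), Matrix.mul_one,
      Matrix.nonsing_inv_mul_cancel_left _ _ ((Matrix.isUnit_iff_isUnit_det _).1 hV)]
  have key : ∀ a b : Fin M.rank → m, (M.submatrix a b).det =
      ((V⁻¹ * P).submatrix a id).det * ((Pᵀ * U⁻¹).submatrix id b).det := fun a b => by
    rw [← Matrix.det_mul, ← Matrix.submatrix_mul _ _ _ _ _ Function.bijective_id, ← hM]
  rw [key, key, key, key]
  ring

/-! ### One-parameter families of Hermitian matrices -/

section

variable {m d : Type*} [Fintype m] [Fintype d]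

theorem hermForm_smul (H : Matrix m m ℂ) (c : ℝ) (x : m → ℂ) :
    hermForm H ((c : ℂ) • x) = c ^ 2 * hermForm H x := by
  simp only [hermForm, star_smul, Matrix.mulVec_smul, smul_dotProduct, dotProduct_smul,
    smul_eq_mul, RCLike.star_def, Complex.conj_ofReal, Complex.re_ofReal_mul]
  ring

theorem continuous_hermForm (ε : ℝ) (B : Matrix m d ℂ) :
    Continuous fun p : Matrix m m ℂ × (d → ℂ) => ε * hermForm p.1 (B *ᵥ p.2) := by
  have h1 : Continuous fun p : Matrix m m ℂ × (d → ℂ) => B *ᵥ p.2 :=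
    continuous_const.matrix_mulVec continuous_snd
  exact continuous_const.mul (Complex.continuous_re.comp
    (h1.star.dotProduct (continuous_fst.matrix_mulVec h1)))

theorem tendsto_hermForm (ε : ℝ) {H : ℝ → Matrix m m ℂ} {x : ℝ} (hH : ContinuousAt H x)
    (B : Matrix m d ℂ) (v : d → ℂ) :
    Tendsto (fun z : ℝ × (d → ℂ) => ε * hermForm (H z.1) (B *ᵥ z.2)) (𝓝 (x, v))
      (𝓝 (ε * hermForm (H x) (B *ᵥ v))) := by
  have h1 := hH.tendsto
  have h2 : Tendsto (fun z : ℝ × (d → ℂ) => H z.1) (𝓝 (x, v)) (𝓝 (H x)) :=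
    h1.comp (continuous_fst.tendsto (x, v))
  have h3 : Tendsto (fun z : ℝ × (d → ℂ) => (H z.1, z.2)) (𝓝 (x, v)) (𝓝 (H x, v)) :=
    h2.prodMk_nhds (continuous_snd.tendsto (x, v))
  have h4 := (continuous_hermForm ε B).tendsto (H x, v)
  have h5 := h4.comp h3
  exact h5

/-- Positivity on the compact unit sphere is an open condition, and homogeneity extends it to all
nonzero vectors. -/
theorem IsPosAlong.eventually {ε : ℝ} {H : ℝ → Matrix m m ℂ} {x : ℝ} {B : Matrix m d ℂ}
    (hB : IsPosAlong ε (H x) B) (hH : ContinuousAt H x) : ∀ᶠ y in 𝓝 x, IsPosAlong ε (H y) B := by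
  have hs : ∀ᶠ y in 𝓝 x, ∀ v ∈ Metric.sphere (0 : d → ℂ) 1, 0 < ε * hermForm (H y) (B *ᵥ v) :=
    (isCompact_sphere _ _).eventually_forall_of_forall_eventually fun v hv =>
      (tendsto_hermForm ε hH B v).eventually (lt_mem_nhds (hB v (ne_zero_of_mem_unit_sphere ⟨v, hv⟩)))
  filter_upwards [hs] with y hy v hv
  have hn : 0 < ‖v‖ := norm_pos_iff.2 hv
  have h1 := hy (((‖v‖⁻¹ : ℝ) : ℂ) • v) (by
    rw [mem_sphere_zero_iff_norm, norm_smul, Complex.norm_real, norm_inv, norm_norm,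
      inv_mul_cancel₀ hn.ne'])
  rw [Matrix.mulVec_smul, hermForm_smul, mul_left_comm] at h1
  exact pos_of_mul_pos_right h1 (by positivity)

variable [DecidableEq m]

theorem eventually_signIndex_le (ε : ℝ) {H : ℝ → Matrix m m ℂ} (hH : ∀ y, (H y).IsHermitian)
    {x : ℝ} (hc : ContinuousAt H x) : ∀ᶠ y in 𝓝 x, signIndex ε (hH x) ≤ signIndex ε (hH y) := by
  obtain ⟨B, hB⟩ := exists_isPosAlong ε (hH x)
  filter_upwards [hB.eventually hc] with y hy
  have := hy.card_le_signIndex (hH y)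
  rwa [Fintype.card_subtype] at this

/-- The number of positive eigenvalues is constant in a continuous family of Hermitian matrices of
constant rank. -/
theorem signIndex_eq_of_isPreconnected {H : ℝ → Matrix m m ℂ}
    (hH : ∀ y, (H y).IsHermitian) (hc : Continuous H) {S : Set ℝ} (hS : IsPreconnected S)
    {r : ℕ} (hr : ∀ y ∈ S, (H y).rank = r) {y z : ℝ} (hy : y ∈ S) (hz : z ∈ S) :
    signIndex 1 (hH y) = signIndex 1 (hH z) := by
  refine hS.constant (f := fun y => signIndex 1 (hH y)) (fun y hy => ?_) hy hz
  refine tendsto_nhds_of_eventually_eq ?_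
  filter_upwards [nhdsWithin_le_nhds (eventually_signIndex_le 1 hH hc.continuousAt),
    nhdsWithin_le_nhds (eventually_signIndex_le (-1) hH hc.continuousAt),
    self_mem_nhdsWithin] with z h1 h2 hz
  have h3 := (signIndex_add_signIndex (hH y)).trans (hr y hy)
  have h4 := (signIndex_add_signIndex (hH z)).trans (hr z hz)
  -- Neither index can drop near `y` and their sum is fixed, so both are locally constant.
  omega

/-- In an eigenbasis of `M x`, as many columns vanish at `x` as the nullity `c`, so the determinant
vanishes to order at least `c`. A simple zero therefore forces `c ≤ 1`. -/
theorem card_le_rank_add_one_of_det_eq {M : ℝ → Matrix m m ℂ} {x : ℝ}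
    (hx : (M x).IsHermitian) (hd : ∀ i j, DifferentiableAt ℝ (fun y => M y i j) x)
    {G : ℝ → ℂ} (hG : ContinuousAt G x) (hGx : G x ≠ 0)
    (hdet : ∀ y, (M y).det = ((y - x : ℝ) : ℂ) * G y) :
    Fintype.card m ≤ (M x).rank + 1 := by
  by_contra hlt
  let U : Matrix m m ℂ := hx.eigenvectorUnitary.1
  let N : ℝ → Matrix m m ℂ := fun y => M y * U
  have hNd : ∀ i j, DifferentiableAt ℝ (fun y => N y i j) x := fun i j => by
    simp only [N, Matrix.mul_apply]
    exact DifferentiableAt.fun_sum fun k _ => (hd i k).mul_const _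
  have hN0 : ∀ i j, hx.eigenvalues j = 0 → N x i j = 0 := fun i j hj => by
    have h1 : N x i j = (M x *ᵥ (hx.eigenvectorBasis j).ofLp) i := rfl
    rw [h1, hx.mulVec_eigenvectorBasis, hj]
    simp
  -- The vanishing columns are divided by `y - x`; `dslope` fills in the derivative at `x` and keeps
  -- the quotient continuous there.
  let K : ℝ → Matrix m m ℂ := fun y => Matrix.of fun i j =>
    if hx.eigenvalues j = 0 then dslope (fun y => N y i j) x y else N y i j
  let c := (Finset.univ.filter fun j => hx.eigenvalues j = 0).card
  have hc : 2 ≤ c := by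
    have h1 := hx.rank_eq_card_non_zero_eigs
    rw [Fintype.card_subtype] at h1
    have h2 := Finset.card_filter_add_card_filter_not (s := Finset.univ)
      (fun j => hx.eigenvalues j = 0)
    rw [Finset.card_univ] at h2
    simp only [c]
    simp only [ne_eq] at h1
    omega
  have hK : ∀ y, (N y).det = ((y - x : ℝ) : ℂ) ^ c * (K y).det := fun y => by
    have h1 : N y = Matrix.of fun i j =>
        (if hx.eigenvalues j = 0 then ((y - x : ℝ) : ℂ) else 1) * K y i j := by
      ext i j
      simp only [K, Matrix.of_apply]
      split_ifs with hj
      · have := sub_smul_dslope (fun y => N y i j) x y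
        rw [hN0 i j hj, sub_zero, Complex.real_smul] at this
        exact this.symm
      · rw [one_mul]
    rw [h1, Matrix.det_mul_row, Finset.prod_ite]
    simp [c]
  have hKc : ContinuousAt (fun y => (K y).det) x := by
    have h1 : ContinuousAt K x := by
      refine continuousAt_pi.2 fun i => continuousAt_pi.2 fun j => ?_
      simp only [K, Matrix.of_apply]
      split_ifs
      · exact continuousAt_dslope_same.2 (hNd i j)
      · exact (hNd i j).continuousAt
    exact ((continuous_id.matrix_det (n := m) (R := ℂ)).continuousAt).comp h1
  have hU : U.det ≠ 0 := by
    have h1 : star U * U = 1 := Unitary.coe_star_mul_self hx.eigenvectorUnitary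
    intro h0
    have h2 := congrArg Matrix.det h1
    rw [Matrix.det_mul, h0] at h2
    simp at h2
  -- After one factor `y - x` is cancelled, at least one remains because `c ≥ 2`; the limit at `x`
  -- then contradicts `G x * U.det ≠ 0`.
  have heq : ∀ᶠ y in 𝓝[≠] x, G y * U.det = ((y - x : ℝ) : ℂ) ^ (c - 1) * (K y).det := by
    filter_upwards [self_mem_nhdsWithin] with y hy
    have hyx : ((y - x : ℝ) : ℂ) ≠ 0 := Complex.ofReal_ne_zero.2 (sub_ne_zero.2 hy)
    refine mul_left_cancel₀ hyx ?_
    rw [← mul_assoc, ← hdet, ← Matrix.det_mul, ← mul_assoc, ← pow_succ',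
      Nat.sub_add_cancel (by omega)]
    exact hK y
  have hpow : ContinuousAt (fun y : ℝ => ((y - x : ℝ) : ℂ) ^ (c - 1)) x := by fun_prop
  have hlim : G x * U.det = ((x - x : ℝ) : ℂ) ^ (c - 1) * (K x).det := tendsto_nhds_unique
    ((((hG.mul_const U.det).tendsto).mono_left nhdsWithin_le_nhds).congr' heq)
    (((hpow.mul hKc).tendsto).mono_left nhdsWithin_le_nhds)
  rw [sub_self, Complex.ofReal_zero, zero_pow (by omega), zero_mul] at hlim
  exact mul_ne_zero hGx hU hlim

/-- The signature jumps of a Hermitian family at a point where the rank may drop. -/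
theorem exists_signIndex_jump {H : ℝ → Matrix m m ℂ} (hH : ∀ y, (H y).IsHermitian)
    (hd : ∀ i j, Differentiable ℝ fun y => H y i j) {x : ℝ} {r k : ℕ}
    (hr : ∀ᶠ y in 𝓝[≠] x, (H y).rank ≤ r) (e : Fin r → m) {G : ℝ → ℂ} (hG : ContinuousAt G x)
    (hGx : G x ≠ 0) (hdet : ∀ y, ((H y).submatrix e e).det = ((y - x : ℝ) : ℂ) ^ k * G y) :
    ∃ p₁ q₁ p₂ q₂ : ℕ,
      (∀ᶠ y in 𝓝[>] x, signIndex 1 (hH y) = p₁ ∧ signIndex (-1) (hH y) = q₁) ∧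
      (∀ᶠ y in 𝓝[<] x, signIndex 1 (hH y) = p₂ ∧ signIndex (-1) (hH y) = q₂) ∧
      p₁ + q₁ = r ∧ p₂ + q₂ = r ∧ Even (q₁ + q₂ + k) ∧
      signIndex 1 (hH x) ≤ p₁ ∧ signIndex 1 (hH x) ≤ p₂ ∧
      signIndex (-1) (hH x) ≤ q₁ ∧ signIndex (-1) (hH x) ≤ q₂ ∧
      (k = 1 → r ≤ signIndex 1 (hH x) + signIndex (-1) (hH x) + 1) := by
  have hc : Continuous H := continuous_pi fun i => continuous_pi fun j => (hd i j).continuous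
  have hdet0 : ∀ᶠ y in 𝓝[≠] x, ((H y).submatrix e e).det ≠ 0 := by
    filter_upwards [nhdsWithin_le_nhds (hG.eventually_ne hGx), self_mem_nhdsWithin] with y h1 hy
    rw [hdet]
    exact mul_ne_zero (pow_ne_zero _ (Complex.ofReal_ne_zero.2 (sub_ne_zero.2 hy))) h1
  have hrank : ∀ᶠ y in 𝓝[≠] x, (H y).rank = r := by
    filter_upwards [hr, hdet0] with y h1 h2
    exact le_antisymm h1 (det_submatrix_ne_zero_le_rank h2)
  -- Principal minors of Hermitian matrices are real, so `G` is real off `x`, and by continuity at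
  -- `x`.
  have hGim : (G x).im = 0 := by
    have h1 : ∀ᶠ y in 𝓝[≠] x, (G y).im = 0 := by
      filter_upwards [self_mem_nhdsWithin] with y hy
      have h2 := im_det_eq_zero ((hH y).submatrix e)
      rw [hdet, ← Complex.ofReal_pow, Complex.im_ofReal_mul] at h2
      exact (mul_eq_zero.1 h2).resolve_left (pow_ne_zero _ (sub_ne_zero.2 hy))
    have h3 : Tendsto (fun y => (G y).im) (𝓝[≠] x) (𝓝 (G x).im) :=
      ((Complex.continuous_im.continuousAt.comp hG).tendsto).mono_left nhdsWithin_le_nhds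
    exact tendsto_nhds_unique h3 (tendsto_const_nhds.congr' (h1.mono fun y hy => hy.symm))
  have hGre : (G x).re ≠ 0 := fun h => hGx (Complex.ext h hGim)
  have hGs : ∀ᶠ y in 𝓝 x, 0 < (G x).re * (G y).re := by
    have h1 : ContinuousAt (fun y => (G x).re * (G y).re) x :=
      continuousAt_const.mul (Complex.continuous_re.continuousAt.comp hG)
    exact h1.eventually (lt_mem_nhds (mul_self_pos.2 hGre))
  have hsign : ∀ᶠ y in 𝓝[≠] x,
      0 < (-1) ^ signIndex (-1) (hH y) * ((y - x) ^ k * (G x).re) := by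
    filter_upwards [hrank, hdet0, nhdsWithin_le_nhds hGs] with y h1 h2 h3
    have h4 := neg_one_pow_signIndex_mul_det_pos ((hH y).submatrix e) h2
    have h5 := signIndex_add_signIndex (hH y)
    have h6 := signIndex_add_signIndex ((hH y).submatrix e)
    rw [Matrix.rank_of_det_ne_zero h2, Fintype.card_fin] at h6
    have h7 := signIndex_submatrix_le 1 (hH y) e
    have h8 := signIndex_submatrix_le (-1) (hH y) e
    -- The principal block has the same rank `r` as `H y` and neither of its indices is larger, so
    -- the indices agree and its determinant shows the parity of the negative index of `H y`.
    rw [show signIndex (-1) ((hH y).submatrix e) = signIndex (-1) (hH y) by omega, hdet,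
      ← Complex.ofReal_pow, Complex.re_ofReal_mul] at h4
    have h9 := mul_pos h4 h3
    refine pos_of_mul_pos_left (b := (G y).re ^ 2) ?_ (sq_nonneg _)
    linarith
  have hall := hrank.and (hsign.and (nhdsWithin_le_nhds ((eventually_signIndex_le 1 hH
    hc.continuousAt).and (eventually_signIndex_le (-1) hH (x := x) hc.continuousAt))))
  rw [eventually_nhdsWithin_iff, Metric.eventually_nhds_iff] at hall
  obtain ⟨δ, hδ, hall⟩ := hall
  have hall' : ∀ y, y ≠ x → |y - x| < δ → _ := fun y h1 h2 => hall (by rwa [Real.dist_eq]) h1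
  -- Sample points symmetric about `x`: the factors `(y - x) ^ k` at them differ exactly by `(-1) ^
  -- k`.
  let y₁ := x + δ / 2
  let y₂ := x - δ / 2
  have a₁ := hall' y₁ (by simp only [y₁]; linarith) (by simp only [y₁]; rw [abs_lt]; constructor <;> linarith)
  have a₂ := hall' y₂ (by simp only [y₂]; linarith) (by simp only [y₂]; rw [abs_lt]; constructor <;> linarith)
  have hR : ∀ y ∈ Set.Ioo x (x + δ), (H y).rank = r := fun y hy =>
    (hall' y hy.1.ne' (by rw [abs_lt]; constructor <;> linarith [hy.1, hy.2])).1
  have hL : ∀ y ∈ Set.Ioo (x - δ) x, (H y).rank = r := fun y hy =>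
    (hall' y hy.2.ne (by rw [abs_lt]; constructor <;> linarith [hy.1, hy.2])).1
  have b₁ := (signIndex_add_signIndex (hH y₁)).trans a₁.1
  have b₂ := (signIndex_add_signIndex (hH y₂)).trans a₂.1
  refine ⟨signIndex 1 (hH y₁), signIndex (-1) (hH y₁), signIndex 1 (hH y₂), signIndex (-1) (hH y₂),
    ?_, ?_, b₁, b₂, ?_, a₁.2.2.1, a₂.2.2.1, a₁.2.2.2, a₂.2.2.2, ?_⟩
  · filter_upwards [Ioo_mem_nhdsGT (show x < x + δ by linarith)] with y hy
    have h1 := signIndex_eq_of_isPreconnected hH hc isPreconnected_Ioo hR hy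
      (show y₁ ∈ Set.Ioo x (x + δ) by simp only [y₁]; constructor <;> linarith)
    have h2 := (signIndex_add_signIndex (hH y)).trans (hR y hy)
    omega
  · filter_upwards [Ioo_mem_nhdsLT (show x - δ < x by linarith)] with y hy
    have h1 := signIndex_eq_of_isPreconnected hH hc isPreconnected_Ioo hL hy
      (show y₂ ∈ Set.Ioo (x - δ) x by simp only [y₂]; constructor <;> linarith)
    have h2 := (signIndex_add_signIndex (hH y)).trans (hL y hy)
    omega
  · have h1 := mul_pos a₁.2.1 a₂.2.1
    rw [show y₁ - x = δ / 2 by simp only [y₁]; ring,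
      show y₂ - x = -1 * (δ / 2) by simp only [y₂]; ring, mul_pow (-1 : ℝ)] at h1
    rw [← neg_one_pow_eq_one_iff_even (R := ℝ) (by norm_num)]
    refine (neg_one_pow_eq_or ℝ _).resolve_right fun h => ?_
    have h2 : 0 < (-1 : ℝ) ^ (signIndex (-1) (hH y₁) + signIndex (-1) (hH y₂) + k) *
        ((δ / 2) ^ k * (G x).re) ^ 2 := by
      rw [pow_add, pow_add]; linarith
    rw [h] at h2
    nlinarith [sq_nonneg ((δ / 2) ^ k * (G x).re)]
  · rintro rfl
    have h1 := card_le_rank_add_one_of_det_eq (M := fun y => (H y).submatrix e e) (x := x)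
      ((hH x).submatrix e) (fun i j => hd _ _ x) hG hGx (fun y => by rw [hdet, pow_one])
    rw [Fintype.card_fin] at h1
    rw [signIndex_add_signIndex]
    exact h1.trans (Nat.add_le_add_right (Matrix.rank_submatrix_le _ _ _) 1)

end

/-! ### Laurent polynomials and their values -/

theorem LaurentPolynomial.exists_eval₂_eq {R S : Type*} [CommRing R] [Field S] (f : R →+* S)
    (q : R[T;T⁻¹]) : ∃ (n : ℕ) (p : Polynomial R), Polynomial.toLaurent p = q * T n ∧
      ∀ z : Sˣ, eval₂ f z q = p.eval₂ f z / (z : S) ^ n := by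
  obtain ⟨n, p, hp⟩ := q.exists_T_pow
  refine ⟨n, p, hp, fun z => ?_⟩
  rw [eq_div_iff (pow_ne_zero _ z.ne_zero), ← eval₂_toLaurent, hp, map_mul, eval₂_T_n]

theorem LaurentPolynomial.continuous_eval₂ {R : Type*} [CommRing R] (f : R →+* ℂ)
    (q : R[T;T⁻¹]) {X : Type*} [TopologicalSpace X] {w : X → ℂˣ}
    (hw : Continuous fun x => (w x : ℂ)) : Continuous fun x => eval₂ f (w x) q := by
  obtain ⟨n, p, -, hq⟩ := LaurentPolynomial.exists_eval₂_eq f q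
  simp only [hq, Polynomial.eval₂_eq_eval_map]
  exact ((p.map f).continuous.comp hw).div (hw.pow n) fun x => pow_ne_zero _ (w x).ne_zero

/-- The value of an integral Laurent polynomial at a nonzero complex number. -/
def laurentEval (z : ℂˣ) : ℤ[T;T⁻¹] →+* ℂ :=
  LaurentPolynomial.eval₂ (Int.castRingHom ℂ) z

theorem eval₂_mapRingHom (z : ℂˣ) (f : ℤ[T;T⁻¹]) :
    LaurentPolynomial.eval₂ (RingHom.id ℂ) z
      (AddMonoidAlgebra.mapRingHom ℤ (Int.castRingHom ℂ) f) = laurentEval z f := by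
  induction f using LaurentPolynomial.induction_on' with
  | add p q hp hq => rw [map_add, map_add, map_add, hp, hq]
  | C_mul_T n a =>
    rw [← LaurentPolynomial.single_eq_C_mul_T, AddMonoidAlgebra.mapRingHom_single,
      LaurentPolynomial.single_eq_C_mul_T, LaurentPolynomial.single_eq_C_mul_T, laurentEval,
      LaurentPolynomial.eval₂_C_mul_T, LaurentPolynomial.eval₂_C_mul_T]
    rfl

/-- A power of `T` is a unit, so clearing denominators reduces `rootMult` to the root multiplicity
of an ordinary polynomial. -/
theorem exists_eq_sub_pow_rootMult_mul (z : ℂˣ) {A : ℤ[T;T⁻¹]} (hA : A ≠ 0) :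
    ∃ G : ℂ[T;T⁻¹], LaurentPolynomial.eval₂ (RingHom.id ℂ) z G ≠ 0 ∧
      ∀ w : ℂˣ, laurentEval w A =
        ((w : ℂ) - z) ^ rootMult z A * LaurentPolynomial.eval₂ (RingHom.id ℂ) w G := by
  set B := AddMonoidAlgebra.mapRingHom ℤ (Int.castRingHom ℂ) A with hB
  set L : ℂ[T;T⁻¹] := LaurentPolynomial.T 1 - LaurentPolynomial.C (z : ℂ) with hL
  have hLev : ∀ w : ℂˣ, LaurentPolynomial.eval₂ (RingHom.id ℂ) w L = (w : ℂ) - z := fun w => by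
    simp [hL]
  have hLp : L = Polynomial.toLaurent (Polynomial.X - Polynomial.C (z : ℂ)) := by
    simp [hL]
  have hB0 : B ≠ 0 := by
    intro h
    apply hA
    ext a
    have h1 := congrArg (fun f : ℂ[T;T⁻¹] => f.coeff a) h
    simpa [hB] using h1
  obtain ⟨n, p, hp, -⟩ := LaurentPolynomial.exists_eval₂_eq (RingHom.id ℂ) B
  have hp0 : p ≠ 0 := by
    rintro rfl
    rw [map_zero] at hp
    exact hB0 ((LaurentPolynomial.isUnit_T n).mul_left_eq_zero.1 hp.symm)
  obtain ⟨g, hg, hgz⟩ := Polynomial.exists_eq_pow_rootMultiplicity_mul_and_not_dvd p hp0 (z : ℂ)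
  set k := p.rootMultiplicity (z : ℂ)
  have hgz' : g.eval (z : ℂ) ≠ 0 := fun h => hgz (Polynomial.dvd_iff_isRoot.2 h)
  let G : ℂ[T;T⁻¹] := Polynomial.toLaurent g * LaurentPolynomial.T (-n)
  have hG : LaurentPolynomial.eval₂ (RingHom.id ℂ) z G ≠ 0 := by
    simp only [G, map_mul, LaurentPolynomial.eval₂_toLaurent, LaurentPolynomial.eval₂_T]
    exact mul_ne_zero hgz' (Units.ne_zero _)
  have hBG : B = L ^ k * G := by
    have h1 : B = B * LaurentPolynomial.T n * LaurentPolynomial.T (-n) := by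
      rw [LaurentPolynomial.mul_T_assoc]; simp
    rw [h1, ← hp, hg, map_mul, map_pow, ← hLp, mul_assoc]
  have hL0 : L ≠ 0 := by
    rw [hLp, Polynomial.toLaurent_ne_zero]
    exact Polynomial.X_sub_C_ne_zero _
  have hk : rootMult z A = k := by
    refine multiplicity_eq_of_dvd_of_not_dvd ⟨G, hBG⟩ ?_
    rintro ⟨Q, hQ⟩
    have h2 : G = L * Q := by
      refine mul_left_cancel₀ (pow_ne_zero k hL0) ?_
      rw [← hBG, ← mul_assoc, ← pow_succ]
      exact hQ
    rw [h2, map_mul, hLev, sub_self, zero_mul] at hG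
    exact hG rfl
  refine ⟨G, hG, fun w => ?_⟩
  rw [hk, ← eval₂_mapRingHom, ← hB, hBG, map_mul, map_pow, hLev]

/-- Integral polynomials with a common complex root are divisible by a nonconstant primitive
polynomial with this root. -/
theorem exists_dvd_of_eval₂_eq_zero (z : ℂ) {p : Polynomial ℤ} (hp : p ≠ 0)
    (hz : p.eval₂ (Int.castRingHom ℂ) z = 0) :
    ∃ g : Polynomial ℤ, g.eval₂ (Int.castRingHom ℂ) z = 0 ∧
      ∀ q : Polynomial ℤ, q.eval₂ (Int.castRingHom ℂ) z = 0 → g ∣ q := by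
  -- The kernel of evaluation at `z` is a nonzero prime ideal of a factorial ring, hence contains a
  -- prime element `g`. By Gauss's lemma divisibility by `g` can be tested over `ℚ`, where failure
  -- would give a Bézout identity that is false at `z`.
  let φ := Polynomial.eval₂RingHom (Int.castRingHom ℂ) z
  have hpr : (RingHom.ker φ).IsPrime := RingHom.ker_isPrime φ
  obtain ⟨g, hg, hgp⟩ := hpr.exists_mem_prime_of_ne_bot
    (Submodule.ne_bot_iff _ |>.2 ⟨p, hz, hp⟩)
  have hgz : g.eval₂ (Int.castRingHom ℂ) z = 0 := hg
  have hdeg : g.natDegree ≠ 0 := by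
    intro h
    rw [Polynomial.eq_C_of_natDegree_eq_zero h, Polynomial.eval₂_C] at hgz
    refine hgp.ne_zero ?_
    rw [Polynomial.eq_C_of_natDegree_eq_zero h, show g.coeff 0 = 0 by simpa using hgz, map_zero]
  have hprim := hgp.irreducible.isPrimitive hdeg
  have hirr := (Polynomial.IsPrimitive.Int.irreducible_iff_irreducible_map_cast hprim).1 hgp.irreducible
  have hae : ∀ q : Polynomial ℤ, Polynomial.aeval z (q.map (Int.castRingHom ℚ)) =
      q.eval₂ (Int.castRingHom ℂ) z := fun q => by
    rw [Polynomial.aeval_def, Polynomial.eval₂_map]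
    congr 1
  refine ⟨g, hgz, fun q hq => ?_⟩
  rw [Polynomial.IsPrimitive.Int.dvd_iff_map_cast_dvd_map_cast g q hprim]
  refine (hirr.dvd_iff_not_isCoprime).2 ?_
  rintro ⟨a, b, hab⟩
  have h1 := congrArg (Polynomial.aeval z) hab
  rw [map_add, map_mul, map_mul, hae, hae, hgz, hq] at h1
  simp at h1

/-- If all the quotients `f i / A` vanished at `z`, they would share a factor `g` with `g(z) = 0`.
Then `A * g` would divide the gcd `A`, making `g` a unit. -/
theorem exists_eq_mul_and_laurentEval_ne_zero {ι : Type*} (z : ℂˣ) {A : ℤ[T;T⁻¹]} (hA : A ≠ 0)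
    {f : ι → ℤ[T;T⁻¹]} (h : ∀ d, d ∣ A ↔ ∀ i, d ∣ f i) :
    ∃ i q, f i = A * q ∧ laurentEval z q ≠ 0 := by
  choose q hq using (h A).1 dvd_rfl
  by_contra! hne
  have hz : ∀ i, laurentEval z (q i) = 0 := fun i => hne i (q i) (hq i)
  choose n p hp hpe using fun i => LaurentPolynomial.exists_eval₂_eq (Int.castRingHom ℂ) (q i)
  have hpz : ∀ i, (p i).eval₂ (Int.castRingHom ℂ) (z : ℂ) = 0 := fun i => by
    have h1 := hpe i z
    rw [show LaurentPolynomial.eval₂ (Int.castRingHom ℂ) z (q i) = 0 from hz i] at h1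
    exact (div_eq_zero_iff.1 h1.symm).resolve_right (pow_ne_zero _ z.ne_zero)
  have hex : ∃ i, p i ≠ 0 := by
    by_contra! h0
    refine hA (zero_dvd_iff.1 ((h 0).2 fun i => ?_))
    have h1 := hp i
    rw [h0, map_zero] at h1
    rw [hq, (LaurentPolynomial.isUnit_T (n i)).mul_left_eq_zero.1 h1.symm, mul_zero]
  obtain ⟨j, hj⟩ := hex
  obtain ⟨g, hgz, hg⟩ := exists_dvd_of_eval₂_eq_zero (z : ℂ) hj (hpz j)
  have hdvd : A * Polynomial.toLaurent g ∣ A := (h _).2 fun i => by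
    rw [hq]
    refine mul_dvd_mul_left A ?_
    rw [← (LaurentPolynomial.isUnit_T (n i)).dvd_mul_right, ← hp]
    exact map_dvd _ (hg _ (hpz i))
  have hu : IsUnit (Polynomial.toLaurent g : ℤ[T;T⁻¹]) := by
    refine isUnit_of_dvd_one ((mul_dvd_mul_iff_left hA).1 ?_)
    rwa [mul_one]
  refine (hu.map (laurentEval z)).ne_zero ?_
  rw [laurentEval, LaurentPolynomial.eval₂_toLaurent, hgz]

/-! ### Minors of the Alexander matrix and of the Tristram matrix -/

theorem tristramMatrix_eq_smul {n : ℕ} (V : Matrix (Fin n) (Fin n) ℤ) (ω : Circle) :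
    tristramMatrix V ω = ((ω : ℂ)⁻¹ - 1) • (alexanderMatrix V).map (laurentEval (Circle.toUnits ω)) := by
  have h0 : (ω : ℂ) ≠ 0 := ω.coe_ne_zero
  ext i j
  simp only [tristramMatrix, alexanderMatrix, laurentEval, Matrix.add_apply, Matrix.smul_apply,
    Matrix.map_apply, Matrix.sub_apply, Matrix.transpose_apply, smul_eq_mul, map_sub, map_mul,
    LaurentPolynomial.eval₂_T, LaurentPolynomial.eval₂_C, zpow_one, Circle.toUnits_apply,
    Units.val_mk0, eq_intCast (Int.castRingHom ℂ)]
  field_simp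
  ring

theorem det_submatrix_tristramMatrix {n k : ℕ} (V : Matrix (Fin n) (Fin n) ℤ) (ω : Circle)
    (r c : Fin k → Fin n) :
    ((tristramMatrix V ω).submatrix r c).det = ((ω : ℂ)⁻¹ - 1) ^ k *
      laurentEval (Circle.toUnits ω) ((alexanderMatrix V).submatrix r c).det := by
  rw [tristramMatrix_eq_smul, Matrix.submatrix_smul, Pi.smul_apply, Pi.smul_apply, Matrix.det_smul,
    Fintype.card_fin, RingHom.map_det]
  rfl

/-- A matrix of rank `ρ` has a nonzero `ρ`-minor, but `Δⱼ = 0` makes all minors of size `n + 1 - j`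
vanish identically. -/
theorem rank_tristramMatrix_le {n i : ℕ} {V : Matrix (Fin n) (Fin n) ℤ}
    (h : ∀ j, 1 ≤ j → j < i → IsAlexanderPolynomial V j 0) (ω : Circle) :
    (tristramMatrix V ω).rank ≤ n + 1 - i := by
  by_contra! hlt
  have hle := (tristramMatrix V ω).rank_le_width
  obtain ⟨j, hj⟩ : ∃ j, (tristramMatrix V ω).rank = n + 1 - j ∧ 1 ≤ j ∧ j < i :=
    ⟨n + 1 - (tristramMatrix V ω).rank, by omega⟩
  have hmin := exists_minor_ne_zero (tristramMatrix V ω)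
  rw [hj.1] at hmin
  obtain ⟨r, c, hrc⟩ := hmin
  rw [det_submatrix_tristramMatrix, zero_dvd_iff.1 ((h j hj.2.1 hj.2.2 0).1 dvd_rfl r c),
    map_zero, mul_zero] at hrc
  exact hrc rfl

/-! ### The signature function along the circle -/

/-- The point `e^{2πiy}` of the circle. -/
def circlePoint (y : ℝ) : Circle := Circle.exp (2 * Real.pi * y)

theorem coe_circlePoint (y : ℝ) :
    (circlePoint y : ℂ) = Complex.exp ((2 * Real.pi * Complex.I) * y) := by
  rw [circlePoint, Circle.coe_exp]
  congr 1
  push_cast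
  ring

theorem hasDerivAt_circlePoint (x : ℝ) :
    HasDerivAt (fun y : ℝ => (circlePoint y : ℂ))
      (circlePoint x * (2 * Real.pi * Complex.I)) x := by
  simp only [coe_circlePoint]
  have h1 : HasDerivAt (fun y : ℝ => (2 * Real.pi * Complex.I) * (y : ℂ))
      (2 * Real.pi * Complex.I) x := by
    simpa using (Complex.ofRealCLM.hasDerivAt (x := x)).const_mul (2 * Real.pi * Complex.I : ℂ)
  exact h1.cexp

theorem continuous_circlePoint : Continuous fun y : ℝ => (circlePoint y : ℂ) :=
  continuous_iff_continuousAt.2 fun x => (hasDerivAt_circlePoint x).continuousAt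

theorem eventually_circlePoint_ne (x : ℝ) : ∀ᶠ y in 𝓝[≠] x, (circlePoint y : ℂ) ≠ circlePoint x :=
  (hasDerivAt_circlePoint x).eventually_ne
    (mul_ne_zero (Circle.coe_ne_zero _) Complex.two_pi_I_ne_zero)

theorem differentiable_tristramMatrix {n : ℕ} (V : Matrix (Fin n) (Fin n) ℤ) (i j : Fin n) :
    Differentiable ℝ fun y => tristramMatrix V (circlePoint y) i j := by
  have h : Differentiable ℝ fun y : ℝ => (circlePoint y : ℂ) :=
    fun x => (hasDerivAt_circlePoint x).differentiableAt
  have h' : Differentiable ℝ fun y : ℝ => (circlePoint y : ℂ)⁻¹ :=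
    h.inv fun y => Circle.coe_ne_zero _
  simp only [tristramMatrix, Matrix.add_apply, Matrix.smul_apply, smul_eq_mul]
  fun_prop

/-- Some principal minor of the Tristram matrix vanishes exactly to the order `rootMult`. -/
theorem exists_principal_minor_eq {n i : ℕ} {V : Matrix (Fin n) (Fin n) ℤ} {A : ℤ[T;T⁻¹]}
    (hA : A ≠ 0) (hi : IsAlexanderPolynomial V i A)
    (hlt : ∀ j, 1 ≤ j → j < i → IsAlexanderPolynomial V j 0) {x : ℝ}
    (hx : (circlePoint x : ℂ) ≠ 1) :
    ∃ (e : Fin (n + 1 - i) → Fin n) (G : ℝ → ℂ), ContinuousAt G x ∧ G x ≠ 0 ∧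
      ∀ y, ((tristramMatrix V (circlePoint y)).submatrix e e).det =
        ((y - x : ℝ) : ℂ) ^ rootMult (circlePoint x : ℂ) A * G y := by
  let w : ℝ → ℂˣ := fun y => Circle.toUnits (circlePoint y)
  have hw : Continuous fun y => (w y : ℂ) := continuous_circlePoint
  have hev : ∀ q, Continuous fun y => laurentEval (w y) q := fun q =>
    LaurentPolynomial.continuous_eval₂ _ q hw
  obtain ⟨⟨r, c⟩, q, hq, hqx⟩ := exists_eq_mul_and_laurentEval_ne_zero (w x) hA
    (f := fun s : (Fin (n + 1 - i) ↪o Fin n) × (Fin (n + 1 - i) ↪o Fin n) =>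
      ((alexanderMatrix V).submatrix s.1 s.2).det)
    (fun d => (hi d).trans ⟨fun h s => h s.1 s.2, fun h r c => h (r, c)⟩)
  obtain ⟨q', hq'⟩ := (hi A).1 dvd_rfl c r
  obtain ⟨qr, hqr⟩ := (hi A).1 dvd_rfl r r
  obtain ⟨qc, hqc⟩ := (hi A).1 dvd_rfl c c
  obtain ⟨G, hG, hAG⟩ := exists_eq_sub_pow_rootMult_mul (w x) hA
  have hGc : Continuous fun y => LaurentPolynomial.eval₂ (RingHom.id ℂ) (w y) G :=
    LaurentPolynomial.continuous_eval₂ _ G hw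
  have hs : ∀ᶠ y in 𝓝[≠] x, (circlePoint y : ℂ)⁻¹ - 1 ≠ 0 :=
    nhdsWithin_le_nhds ((continuous_circlePoint.continuousAt.eventually_ne hx).mono fun y hy => by
      rwa [sub_ne_zero, ne_eq, inv_eq_one])
  -- The minor identity with the common factor `A` cancelled. This is possible only off `x`, where
  -- `A` is nonzero; the identity reaches `x` by continuity.
  have heq : ∀ᶠ y in 𝓝[≠] x, ‖laurentEval (w y) q‖ * ‖laurentEval (w y) q‖ =
      ‖laurentEval (w y) qr‖ * ‖laurentEval (w y) qc‖ := by
    filter_upwards [hs, eventually_circlePoint_ne x, nhdsWithin_le_nhds (hGc.continuousAt.eventually_ne hG),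
      nhdsWithin_le_nhds ((hev q).continuousAt.eventually_ne hqx)] with y h1 h2 h3 h4
    have hAy : laurentEval (w y) A ≠ 0 := by
      rw [hAG]
      exact mul_ne_zero (pow_ne_zero _ (sub_ne_zero.2 h2)) h3
    set H := tristramMatrix V (circlePoint y) with hH
    set a := ((circlePoint y : ℂ)⁻¹ - 1) ^ (n + 1 - i) with ha
    have ha0 : a ≠ 0 := pow_ne_zero _ h1
    have drc : (H.submatrix r c).det = a * (laurentEval (w y) A * laurentEval (w y) q) := by
      rw [hH, det_submatrix_tristramMatrix, ← ha, ← map_mul, ← hq]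
    have dcr : (H.submatrix c r).det = a * (laurentEval (w y) A * laurentEval (w y) q') := by
      rw [hH, det_submatrix_tristramMatrix, ← ha, ← map_mul, ← hq']
    have drr : (H.submatrix r r).det = a * (laurentEval (w y) A * laurentEval (w y) qr) := by
      rw [hH, det_submatrix_tristramMatrix, ← ha, ← map_mul, ← hqr]
    have dcc : (H.submatrix c c).det = a * (laurentEval (w y) A * laurentEval (w y) qc) := by
      rw [hH, det_submatrix_tristramMatrix, ← ha, ← map_mul, ← hqc]
    have hrank : H.rank = n + 1 - i := le_antisymm (rank_tristramMatrix_le hlt _)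
      (det_submatrix_ne_zero_le_rank (f := r) (g := c) (by
        rw [drc]; exact mul_ne_zero ha0 (mul_ne_zero hAy h4)))
    have hconj : ‖(H.submatrix c r).det‖ = ‖(H.submatrix r c).det‖ := by
      rw [← norm_star (H.submatrix r c).det, ← Matrix.det_conjTranspose,
        Matrix.conjTranspose_submatrix, (tristramMatrix_isHermitian V _).eq]
    have hm := congrArg norm (det_submatrix_mul_det_submatrix H hrank r c)
    rw [norm_mul, hconj, norm_mul, drc, drr, dcc] at hm
    simp only [norm_mul] at hm
    have hpos : 0 < ‖a‖ * ‖laurentEval (w y) A‖ := by positivity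
    refine mul_left_cancel₀ (pow_ne_zero 2 hpos.ne') ?_
    linarith
  have hlim : ‖laurentEval (w x) q‖ * ‖laurentEval (w x) q‖ =
      ‖laurentEval (w x) qr‖ * ‖laurentEval (w x) qc‖ :=
    tendsto_nhds_unique
      (((((hev q).norm.mul (hev q).norm).tendsto x).mono_left nhdsWithin_le_nhds).congr' heq)
      ((((hev qr).norm.mul (hev qc).norm).tendsto x).mono_left nhdsWithin_le_nhds)
  have hqr0 : laurentEval (w x) qr ≠ 0 := by
    intro h0
    rw [h0, norm_zero, zero_mul] at hlim
    exact hqx (norm_eq_zero.1 (mul_self_eq_zero.1 hlim))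
  -- This slope converts powers of `circlePoint y - circlePoint x` into powers of `y - x`; at `x` it
  -- is the nonzero derivative.
  have hds : ContinuousAt (dslope (fun y : ℝ => (circlePoint y : ℂ)) x) x :=
    continuousAt_dslope_same.2 (hasDerivAt_circlePoint x).differentiableAt
  refine ⟨r, fun y => ((circlePoint y : ℂ)⁻¹ - 1) ^ (n + 1 - i) *
    ((dslope (fun y : ℝ => (circlePoint y : ℂ)) x y) ^ rootMult (circlePoint x : ℂ) A *
      LaurentPolynomial.eval₂ (RingHom.id ℂ) (w y) G * laurentEval (w y) qr), ?_, ?_, fun y => ?_⟩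
  · exact ((((continuous_circlePoint.inv₀ fun y => Circle.coe_ne_zero _).sub
      continuous_const).pow _).continuousAt).mul
      (((hds.pow _).mul hGc.continuousAt).mul (hev qr).continuousAt)
  · beta_reduce
    rw [dslope_same, (hasDerivAt_circlePoint x).deriv]
    refine mul_ne_zero (pow_ne_zero _ ?_) (mul_ne_zero (mul_ne_zero (pow_ne_zero _
      (mul_ne_zero (Circle.coe_ne_zero _) Complex.two_pi_I_ne_zero)) hG) hqr0)
    rwa [sub_ne_zero, ne_eq, inv_eq_one]
  · rw [det_submatrix_tristramMatrix, hqr, map_mul]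
    have h1 := sub_smul_dslope (fun y : ℝ => (circlePoint y : ℂ)) x y
    rw [Complex.real_smul] at h1
    have h2 := hAG (w y)
    rw [show ((w y : ℂ) - (w x : ℂ)) = _ from h1.symm, mul_pow] at h2
    rw [show laurentEval (Circle.toUnits (circlePoint y)) A = _ from h2]
    change _ * (_ ^ rootMult (circlePoint x : ℂ) A * _ ^ rootMult (circlePoint x : ℂ) A * _ * _) = _
    ring

/-- The jumps are required at every real `x` over `ω`; two such numbers differ by an integer, a
period of `circlePoint`. -/
theorem eventually_circlePoint_of_eq {P : Circle → Prop} {x x' : ℝ}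
    (h : circlePoint x = circlePoint x') :
    ((∀ᶠ y in 𝓝[>] x, P (circlePoint y)) → ∀ᶠ y in 𝓝[>] x', P (circlePoint y)) ∧
      ((∀ᶠ y in 𝓝[<] x, P (circlePoint y)) → ∀ᶠ y in 𝓝[<] x', P (circlePoint y)) := by
  obtain ⟨m, hm⟩ := Circle.exp_eq_exp.1 h
  have hx : x = x' + m := by
    have h2 : (2 * Real.pi) ≠ 0 := Real.two_pi_pos.ne'
    refine mul_left_cancel₀ h2 ?_
    linarith
  have hp : ∀ y : ℝ, circlePoint (y + m) = circlePoint y := fun y => by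
    refine Circle.exp_eq_exp.2 ⟨m, ?_⟩
    ring
  have ht : Tendsto (fun y : ℝ => y + m) (𝓝 x') (𝓝 x) := by
    rw [hx]; exact (continuous_add_const _).tendsto _
  constructor <;> intro hP
  · have := (tendsto_nhdsWithin_of_tendsto_nhds_of_eventually_within (s := Set.Ioi x) _
      (ht.mono_left (nhdsWithin_le_nhds (s := Set.Ioi x')))
      (by filter_upwards [self_mem_nhdsWithin] with y hy
          have : x' < y := hy
          change x < y + m
          linarith)).eventually hP
    simpa only [hp] using this
  · have := (tendsto_nhdsWithin_of_tendsto_nhds_of_eventually_within (s := Set.Iio x) _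
      (ht.mono_left (nhdsWithin_le_nhds (s := Set.Iio x')))
      (by filter_upwards [self_mem_nhdsWithin] with y hy
          have : y < x' := hy
          change y + m < x
          linarith)).eventually hP
    simpa only [hp] using this

/-- The jumps of the signature function of any integral square matrix `V`: existence, the congruence
modulo `4`, and the case of a simple root. -/
theorem exists_jumps {n : ℕ} (V : Matrix (Fin n) (Fin n) ℤ) {A : ℤ[T;T⁻¹]}
    (hA : IsFirstNonzeroAlexanderPolynomial V A) (ω : Circle) (hω : (ω : ℂ) ≠ 1) :
    ∃ jp jm : ℤ, HasJumpPlus V ω jp ∧ HasJumpMinus V ω jm ∧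
      jp + jm ≡ 2 * (rootMult (ω : ℂ) A : ℤ) [ZMOD 4] ∧
      (rootMult (ω : ℂ) A = 1 → jp = jm ∧ (jp = 1 ∨ jp = -1)) := by
  obtain ⟨hA0, i, -, hi, hlt⟩ := hA
  obtain ⟨x, rfl⟩ : ∃ x, circlePoint x = ω := by
    obtain ⟨t, ht⟩ := Circle.exp_surjective ω
    refine ⟨t / (2 * Real.pi), ?_⟩
    rw [circlePoint, mul_div_cancel₀ _ Real.two_pi_pos.ne', ht]
  obtain ⟨e, G, hG, hGx, hdet⟩ := exists_principal_minor_eq hA0 hi hlt hω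
  have hH := fun y => tristramMatrix_isHermitian V (circlePoint y)
  obtain ⟨p₁, q₁, p₂, q₂, hR, hL, hr₁, hr₂, heven, h1, h2, h3, h4, hk⟩ :=
    exists_signIndex_jump hH (differentiable_tristramMatrix V)
      (Eventually.of_forall fun y => rank_tristramMatrix_le hlt _) e hG hGx hdet
  have hσ : ∀ y, levineTristramSignature V (circlePoint y) =
      (signIndex 1 (hH y) : ℤ) - signIndex (-1) (hH y) := fun y => hermitianSignature_eq _
  have hR' : ∀ᶠ y in 𝓝[>] x, levineTristramSignature V (circlePoint y) = (p₁ : ℤ) - q₁ :=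
    hR.mono fun y hy => by rw [hσ, hy.1, hy.2]
  have hL' : ∀ᶠ y in 𝓝[<] x, levineTristramSignature V (circlePoint y) = (p₂ : ℤ) - q₂ :=
    hL.mono fun y hy => by rw [hσ, hy.1, hy.2]
  refine ⟨((p₁ : ℤ) - q₁) - levineTristramSignature V (circlePoint x),
    -(((p₂ : ℤ) - q₂) - levineTristramSignature V (circlePoint x)), fun x' hx' => ⟨_, ?_, rfl⟩,
    fun x' hx' => ⟨_, ?_, rfl⟩, ?_, fun h => ?_⟩
  · exact tendsto_nhds_of_eventually_eq ((eventually_circlePoint_of_eq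
      (P := fun ω => levineTristramSignature V ω = (p₁ : ℤ) - q₁) hx'.symm).1 hR')
  · exact tendsto_nhds_of_eventually_eq ((eventually_circlePoint_of_eq
      (P := fun ω => levineTristramSignature V ω = (p₂ : ℤ) - q₂) hx'.symm).2 hL')
  -- The value at `ω` cancels in the sum, leaving `2 (q₂ - q₁)` with `q₁ + q₂ + k` even.
  · obtain ⟨t, ht⟩ := heven
    rw [Int.modEq_iff_dvd]
    omega
  -- For `k = 1` parity gives `q₁ ≠ q₂`, while both lie within one of the negative index at `ω`. So
  -- the eigenvalue lost at `ω` is positive on one side and negative on the other.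
  · rw [hσ]
    have hk' := hk h
    obtain ⟨t, ht⟩ := heven
    omega

end

theorem mainTheorem4 (L : OrientedLink) (F : SeifertSurface L) (n : ℕ)
    (V : Matrix (Fin n) (Fin n) ℤ) (hV : F.IsSeifertMatrix V)
    (A : LaurentPolynomial ℤ) (hA : IsFirstNonzeroAlexanderPolynomial V A)
    (ω : Circle) (hω₁ : (ω : ℂ) ≠ 1) (hω₂ : (ω : ℂ) ≠ -1) :
    ∃ jp jm : ℤ, HasJumpPlus V ω jp ∧ HasJumpMinus V ω jm ∧
      jp + jm ≡ 2 * (rootMult (ω : ℂ) A : ℤ) [ZMOD 4] ∧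
      (rootMult (ω : ℂ) A = 1 → jp = jm ∧ (jp = 1 ∨ jp = -1)) :=
  exists_jumps V hA ω hω₁
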